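/- \textbf{Proposition (Estimation Error Bound).} Let $V$ be a finite set, let $\mathcal L=\{L_1,\dots,L_K\}$ be Laplacians of undirected graphs on $V$ with nonnegative edge weights, and let $\mathcal X=\{(I+L_i)^{-1}: i\le K\}$ be the corresponding forest matrices. Let $s\in\mathbb R^{V}$ and $\Theta^*=ss^\top$. Let $\mathcal S\subseteq\mathbb R^{V\times V}$ be a linear subspace with $\Theta^*\in\mathcal S$ (for example $\mathcal S=\mathbb R^{V\times V}$, or the symmetric matrices, or, if $\sum_i s_i=0$, the symmetric matrices $\Theta$ with $\Theta\mathbf 1=0$). Write $\langle A,B\rangle=\mathrm{tr}(A^\top B)$, $\|\cdot\|_F$ for the Frobenius norm and $\|\cdot\|_{\mathrm{nuc}}$ for the nuclear norm (the sum of the singular values). Let $T_1\ge 1$, and let $X_1,\dots,X_{T_1}$ be (possibly random, not necessarily independent or identically distributed) elements of $\mathcal X$, namely $X_t=(I+L_{I_t})^{-1}$ with $I_t\in\{1,\dots,K\}$. Observe $Y_t=\langle\Theta^*,X_t\rangle+\eta_t$, where $\eta_1,\dots,\eta_{T_1}$ are independent $N(0,\sigma^2)$ variables with $\sigma^2\le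 1$, and $(\eta_t)_t$ is independent of $(I_t)_t$. Let $\overline{\mathcal M}=\{sa^\top+bs^\top: a,b\in\mathbb R^{V}\}$, let $\Delta_{\overline{\mathcal M}}$ and $\Delta_{\overline{\mathcal M}^\perp}$ be the components of $\Delta$ in $\overline{\mathcal M}$ and in its orthogonal complement for $\langle\cdot,\cdot\rangle$, and let $\mathcal C=\{\Delta\in\mathbb R^{V\times V}:\|\Delta_{\overline{\mathcal M}^\perp}\|_{\mathrm{nuc}}\le 3\|\Delta_{\overline{\mathcal M}}\|_{\mathrm{nuc}}\}$. Given $\kappa>0$ and $\tau_{T_1}^2\ge 0$, say that RSC holds if $$\frac1{2T_1}\sum_{t=1}^{T_1}\langle X_t,\Delta\rangle^2\ \ge\ \frac{\kappa}{2}\|\Delta\|_F^2-\tau_{T_1}^2\|\Delta\|_{\mathrm{nuc}}^2\qquad\text{for all }\Delta\in\mathcal C\cap\mathcal S .$$ Suppose $128\,\tau_{T_1}^2\le\kappa$ and that RSC holds with positive probability. Let $\delta\in(0,1)$ and $\lambda_{T_1}=2\sqrt{2\log(2|V|/\delta)/T_1}$. Then, conditionally on RSC, with probability at least $1-\delta$,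 every minimizer $$\widehat\Theta\in\arg\min_{\Theta\in\mathcal S}\Big\{\frac1{2T_1}\sum_{t=1}^{T_1}(Y_t-\langle X_t,\Theta\rangle)^2+\lambda_{T_1}\|\Theta\|_{\mathrm{nuc}}\Big\}$$ satisfies $$\|\widehat\Theta-\Theta^*\|_F^2\ \le\ \frac{36\,\log(2|V|/\delta)}{\kappa^2\,T_1}.$$ In particular, if the design $X_1,\dots,X_{T_1}$ is deterministic and satisfies RSC, the bound holds with probability at least $1-\delta$. -/

import Mathlib

open scoped Matrix.Norms.Frobenius NNReal

/-- An undirected graph on `V` with nonnegative edge weights, given by its weighted adjacency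
matrix; weight `0` means that there is no edge. -/
structure WeightedGraph (V : Type*) where
  weight : Matrix V V ℝ
  symm : ∀ i j, weight i j = weight j i
  nonneg : ∀ i j, 0 ≤ weight i j
  loopless : ∀ i, weight i i = 0

namespace WeightedGraph

variable {V : Type*} [Fintype V] [DecidableEq V]

/-- The Laplacian `L = D - A`, with `D` the diagonal matrix of weighted degrees. -/
def laplacian (G : WeightedGraph V) : Matrix V V ℝ :=
  Matrix.diagonal (fun i => ∑ j, G.weight i j) - G.weight

/-- The forest matrix `(I + L)⁻¹`. -/
noncomputable def forestMatrix (G : WeightedGraph V) : Matrix V V ℝ :=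
  (1 + G.laplacian)⁻¹

end WeightedGraph

namespace OpinionBandit

variable {V : Type*} [Fintype V] [DecidableEq V]

/-- The trace inner product `⟨A, B⟩ = tr (Aᵀ B)`. -/
def traceInner (A B : Matrix V V ℝ) : ℝ := (A.transpose * B).trace

/-- The nuclear norm: the sum of the singular values (Mathlib's sequence of singular values is
padded with zeros from index `|V|` on). -/
noncomputable def nucNorm (A : Matrix V V ℝ) : ℝ :=
  ∑ i ∈ Finset.range (Fintype.card V), (Matrix.toEuclideanLin A).singularValues i

/-- The true parameter `Θ* = s sᵀ`. -/
def trueParam (s : V → ℝ) : Matrix V V ℝ := Matrix.vecMulVec s s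

/-- The space of all matrices `s aᵀ + b sᵀ`. -/
def modelSpace (s : V → ℝ) : Set (Matrix V V ℝ) :=
  {A | ∃ a b : V → ℝ, A = Matrix.vecMulVec s a + Matrix.vecMulVec b s}

/-- The orthogonal complement of `modelSpace s` for the trace inner product. -/
def modelSpacePerp (s : V → ℝ) : Set (Matrix V V ℝ) :=
  {B | ∀ A ∈ modelSpace s, traceInner A B = 0}

/-- The cone of those `Δ` whose orthogonal decomposition `Δ = A + B` along `modelSpace s` and its
complement satisfies `‖B‖_nuc ≤ 3 ‖A‖_nuc`. -/
def errorCone (s : V → ℝ) : Set (Matrix V V ℝ) :=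
  {Δ | ∃ A ∈ modelSpace s, ∃ B ∈ modelSpacePerp s, Δ = A + B ∧ nucNorm B ≤ 3 * nucNorm A}

/-- Restricted strong convexity of the observation operator `Δ ↦ (⟨X t, Δ⟩)_t`, with curvature `κ`
and tolerance `τ ^ 2`, on the error directions in the cone that lie in the parameter space `S`. -/
def RSC {T₁ : ℕ} (S : Submodule ℝ (Matrix V V ℝ)) (s : V → ℝ) (X : Fin T₁ → Matrix V V ℝ)
    (κ τ : ℝ) : Prop :=
  ∀ Δ ∈ errorCone s, Δ ∈ S →
    κ / 2 * ‖Δ‖ ^ 2 - τ ^ 2 * nucNorm Δ ^ 2 ≤ 1 / (2 * (T₁ : ℝ)) * ∑ t, traceInner (X t) Δ ^ 2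

/-- The nuclear-norm penalized least-squares objective. -/
noncomputable def objective {T₁ : ℕ} (X : Fin T₁ → Matrix V V ℝ) (Y : Fin T₁ → ℝ) (lam : ℝ)
    (Θ : Matrix V V ℝ) : ℝ :=
  1 / (2 * (T₁ : ℝ)) * ∑ t, (Y t - traceInner (X t) Θ) ^ 2 + lam * nucNorm Θ

/-- `Θ` minimizes the penalized least-squares objective over the parameter space `S`. -/
def IsEstimator {T₁ : ℕ} (S : Submodule ℝ (Matrix V V ℝ)) (X : Fin T₁ → Matrix V V ℝ)
    (Y : Fin T₁ → ℝ) (lam : ℝ) (Θ : Matrix V V ℝ) : Prop :=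
  Θ ∈ S ∧ IsMinOn (objective X Y lam) S Θ

end OpinionBandit

/-!
The proof is the analysis of nuclear-norm penalized least squares under restricted strong convexity,
arranged so that the constant `36` and the tolerance `128 τ² ≤ κ` suffice. Write `Θ*` for the true
parameter, `Δ` for the error of a minimizer, `A` and `B` for its components in the model space and
in the orthogonal complement, and `λ` for the penalty level.

*Noise.* For contractions `X t` every word in the `X t` is a contraction, and all mixed moments of
independent centred Gaussians are nonnegative. Expanding into words therefore bounds the moments of
`∑ t, η t • X t` by those of the scalar `∑ t, η t` (`abs_integral_inner_sum_smul_pow_le`), and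
summing over the power series of `cosh` bounds the exponential moments of the operator norm by `|V|`
times the scalar ones. This yields the tail bound `measure_norm_sum_smul_gt_le`, with the
constants of the matrix Laplace transform method, without any trace inequality. Forest matrices are
contractions because `I + L ≥ I`. As the arms take finitely many values and are independent of the
noise, the tail bound survives conditioning on an event of the arms (`ofReal_one_sub_le_cond`).

*Optimality.* Comparing a minimizer with nearby points of the segment towards `Θ*`, rather than
with `Θ*` itself, gives `(1/T) ∑ ⟨X t, Δ⟩² ≤ ⟨noise, Δ⟩ / T + λ (‖Θ*‖ - ‖Θ* + Δ‖)` in the nuclear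
norm, twice the quadratic term of the usual basic inequality (`IsEstimator.sum_sq_le`).

*Geometry.* The component `A` is `α u uᵀ + u cᵀ + d uᵀ` with `u` the normalization of `s` and
`c`, `d` orthogonal to `u`. A subgradient of the nuclear norm at `Θ*` shows that
`‖Θ* + Δ‖ ≥ ‖Θ*‖ + α + ‖B‖`, where `|α|` replaces the larger `‖A‖` of the usual argument
(`exists_model_decomposition`); it also puts `Δ` into the cone. What remains is an inequality between
real numbers, `sq_error_le`, where these two improvements absorb the tolerance term.

All facts about the nuclear norm come from its duality with the operator norm
(`traceInner_le_opNorm_mul_nucNorm`, `exists_dual_certificate`).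
-/

namespace OpinionBandit

open Matrix

/-! ### The trace inner product -/

section TraceInner

variable {V : Type*} [Fintype V]

theorem traceInner_eq_sum (A B : Matrix V V ℝ) : traceInner A B = ∑ i, ∑ j, A i j * B i j := by
  rw [Finset.sum_comm]
  simp [traceInner, Matrix.trace, Matrix.mul_apply]

theorem traceInner_comm (A B : Matrix V V ℝ) : traceInner A B = traceInner B A := by
  simp [traceInner_eq_sum, mul_comm]

theorem traceInner_add_right (A B C : Matrix V V ℝ) :
    traceInner A (B + C) = traceInner A B + traceInner A C := by
  simp [traceInner, Matrix.mul_add]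

theorem traceInner_add_left (A B C : Matrix V V ℝ) :
    traceInner (A + B) C = traceInner A C + traceInner B C := by
  simp [traceInner, Matrix.add_mul]

theorem traceInner_smul_right (c : ℝ) (A B : Matrix V V ℝ) :
    traceInner A (c • B) = c * traceInner A B := by
  simp [traceInner]

theorem traceInner_smul_left (c : ℝ) (A B : Matrix V V ℝ) :
    traceInner (c • A) B = c * traceInner A B := by
  simp [traceInner]

theorem traceInner_vecMulVec (W : Matrix V V ℝ) (x y : V → ℝ) :
    traceInner W (vecMulVec x y) = x ⬝ᵥ W *ᵥ y := by
  simp only [traceInner_eq_sum, vecMulVec_apply, dotProduct, mulVec, Finset.mul_sum]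
  exact Finset.sum_congr rfl fun i _ => Finset.sum_congr rfl fun j _ => by ring

theorem traceInner_self (A : Matrix V V ℝ) : traceInner A A = ‖A‖ ^ 2 := by
  rw [Matrix.frobenius_norm_def, ← Real.sqrt_eq_rpow, Real.sq_sqrt (by positivity),
    traceInner_eq_sum]
  simp [sq]

end TraceInner

/-! ### Duality of the operator norm and the nuclear norm -/

variable {V : Type*} [Fintype V] [DecidableEq V]

/-- The `ℓ²` operator norm of a matrix (the ambient norm on matrices is the Frobenius norm). -/
noncomputable def opNorm (W : Matrix V V ℝ) : ℝ := ‖toEuclideanCLM (n := V) (𝕜 := ℝ) W‖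

theorem norm_toEuclideanLin_le (W : Matrix V V ℝ) (x : EuclideanSpace ℝ V) :
    ‖toEuclideanLin W x‖ ≤ opNorm W * ‖x‖ :=
  (toEuclideanCLM (n := V) (𝕜 := ℝ) W).le_opNorm x

theorem opNorm_le_of_forall {W : Matrix V V ℝ} {C : ℝ} (hC : 0 ≤ C)
    (h : ∀ x, ‖toEuclideanLin W x‖ ≤ C * ‖x‖) : opNorm W ≤ C :=
  ContinuousLinearMap.opNorm_le_bound _ hC h

theorem traceInner_eq_sum_inner {ι : Type*} [Fintype ι]
    (b : OrthonormalBasis ι ℝ (EuclideanSpace ℝ V)) (W A : Matrix V V ℝ) :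
    traceInner W A = ∑ i, inner ℝ (toEuclideanLin W (b i)) (toEuclideanLin A (b i)) := by
  have h1 : traceInner W A = LinearMap.trace ℝ (EuclideanSpace ℝ V)
      ((toEuclideanLin W).adjoint ∘ₗ toEuclideanLin A) := by
    rw [← toEuclideanLin_conjTranspose_eq_adjoint, conjTranspose_eq_transpose_of_trivial,
      toEuclideanLin_eq_toLin_orthonormal, ← Matrix.toLin_mul, Matrix.trace_toLin_eq]
    rfl
  rw [h1, LinearMap.trace_eq_sum_inner _ b]
  simp [LinearMap.adjoint_inner_right]

/-- A right singular basis: an orthonormal basis whose images under `A` are orthogonal, with the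
singular values as their norms. -/
theorem exists_singular_basis (A : Matrix V V ℝ) :
    ∃ b : OrthonormalBasis (Fin (Fintype.card V)) ℝ (EuclideanSpace ℝ V), ∀ i j,
      inner ℝ (toEuclideanLin A (b i)) (toEuclideanLin A (b j)) =
        if i = j then (toEuclideanLin A).singularValues i ^ 2 else 0 := by
  have hn : Module.finrank ℝ (EuclideanSpace ℝ V) = Fintype.card V := finrank_euclideanSpace
  have hs := (toEuclideanLin A).isSymmetric_adjoint_comp_self
  refine ⟨hs.eigenvectorBasis hn, fun i j => ?_⟩
  rw [← LinearMap.adjoint_inner_right, ← LinearMap.comp_apply, hs.apply_eigenvectorBasis,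
    inner_smul_right, OrthonormalBasis.inner_eq_ite]
  split_ifs with h
  · subst h
    rw [(toEuclideanLin A).sq_singularValues_fin hn]
    simp
  · simp

theorem nucNorm_eq_sum_fin (A : Matrix V V ℝ) :
    nucNorm A = ∑ i : Fin (Fintype.card V), (toEuclideanLin A).singularValues i :=
  Finset.sum_range _

theorem nucNorm_nonneg (A : Matrix V V ℝ) : 0 ≤ nucNorm A :=
  Finset.sum_nonneg fun _ _ => LinearMap.singularValues_nonneg _ _

/-- The operator norm and the nuclear norm are in duality. -/
theorem traceInner_le_opNorm_mul_nucNorm (W A : Matrix V V ℝ) :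
    traceInner W A ≤ opNorm W * nucNorm A := by
  obtain ⟨b, hb⟩ := exists_singular_basis A
  rw [traceInner_eq_sum_inner b, nucNorm_eq_sum_fin, Finset.mul_sum]
  refine Finset.sum_le_sum fun i _ => (real_inner_le_norm _ _).trans ?_
  have h1 : ‖toEuclideanLin A (b i)‖ = (toEuclideanLin A).singularValues i := by
    rw [← sq_eq_sq₀ (norm_nonneg _) (LinearMap.singularValues_nonneg _ _),
      ← real_inner_self_eq_norm_sq, hb, if_pos rfl]
  rw [h1]
  refine mul_le_mul_of_nonneg_right ?_ (LinearMap.singularValues_nonneg _ _)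
  simpa using norm_toEuclideanLin_le W (b i)

/-- The duality between the operator norm and the nuclear norm is attained, at the partial isometry
of the polar decomposition. -/
theorem exists_dual_certificate (A : Matrix V V ℝ) :
    ∃ W : Matrix V V ℝ, opNorm W ≤ 1 ∧ traceInner W A = nucNorm A := by
  obtain ⟨b, hb⟩ := exists_singular_basis A
  -- `σ i⁻¹` is `0` when `σ i = 0`, so the kernel of `A` is sent to `0`.
  set σ : Fin (Fintype.card V) → ℝ := fun i => (toEuclideanLin A).singularValues i with hσ
  set w : Fin (Fintype.card V) → EuclideanSpace ℝ V := fun i => (σ i)⁻¹ • toEuclideanLin A (b i)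
    with hw
  have hww : ∀ i j, inner ℝ (w i) (w j) = if i = j then ((σ i)⁻¹ * σ i) ^ 2 else 0 := by
    intro i j
    simp only [hw, real_inner_smul_left, real_inner_smul_right, hb]
    split_ifs with h
    · subst h; ring
    · simp
  set f : EuclideanSpace ℝ V →ₗ[ℝ] EuclideanSpace ℝ V := b.toBasis.constr ℝ w with hf
  have hfb : ∀ i, f (b i) = w i := fun i => by
    rw [hf, ← b.coe_toBasis, Module.Basis.constr_basis]
  have hW : toEuclideanLin (toEuclideanLin.symm f) = f := LinearEquiv.apply_symm_apply _ _
  refine ⟨toEuclideanLin.symm f, opNorm_le_of_forall zero_le_one fun x => ?_, ?_⟩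
  · rw [hW, one_mul]
    refine le_of_sq_le_sq ?_ (norm_nonneg _)
    have hx : f x = ∑ i, b.repr x i • w i := by
      conv_lhs => rw [← b.sum_repr x]
      simp [hfb]
    rw [hx, ← real_inner_self_eq_norm_sq, sum_inner, ← b.sum_sq_norm_inner_right x]
    refine Finset.sum_le_sum fun i _ => ?_
    simp only [inner_sum, real_inner_smul_left, real_inner_smul_right, hww]
    simp only [mul_ite, mul_zero, Finset.sum_ite_eq, Finset.mem_univ, if_true,
      b.repr_apply_apply, Real.norm_eq_abs, sq_abs]
    rcases eq_or_ne (σ i) 0 with h | h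
    · simp [h, sq_nonneg]
    · rw [inv_mul_cancel₀ h]; simp [sq]
  · rw [traceInner_eq_sum_inner b, hW, nucNorm_eq_sum_fin]
    refine Finset.sum_congr rfl fun i _ => ?_
    rw [hfb, hw, real_inner_smul_left, hb, if_pos rfl]
    change (σ i)⁻¹ * σ i ^ 2 = σ i
    rcases eq_or_ne (σ i) 0 with h | h
    · simp [h]
    · field_simp

theorem nucNorm_add_le (A B : Matrix V V ℝ) : nucNorm (A + B) ≤ nucNorm A + nucNorm B := by
  obtain ⟨W, hW, h⟩ := exists_dual_certificate (A + B)
  rw [← h, traceInner_add_right]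
  have hA := traceInner_le_opNorm_mul_nucNorm W A
  have hB := traceInner_le_opNorm_mul_nucNorm W B
  have := nucNorm_nonneg A
  have := nucNorm_nonneg B
  nlinarith

theorem nucNorm_smul_le (A : Matrix V V ℝ) {c : ℝ} (hc : 0 ≤ c) :
    nucNorm (c • A) ≤ c * nucNorm A := by
  obtain ⟨W, hW, h⟩ := exists_dual_certificate (c • A)
  rw [← h, traceInner_smul_right]
  have hA := traceInner_le_opNorm_mul_nucNorm W A
  have := nucNorm_nonneg A
  exact mul_le_mul_of_nonneg_left (by nlinarith) hc

theorem dotProduct_mulVec_le (W : Matrix V V ℝ) (x y : V → ℝ) :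
    x ⬝ᵥ W *ᵥ y ≤ opNorm W * (√(x ⬝ᵥ x) * √(y ⬝ᵥ y)) := by
  have hn : ∀ z : V → ℝ, ‖WithLp.toLp 2 z‖ = √(z ⬝ᵥ z) := fun z => by
    rw [EuclideanSpace.norm_eq]; simp [dotProduct, sq]
  have h1 : x ⬝ᵥ W *ᵥ y = inner ℝ (WithLp.toLp 2 x) (toEuclideanLin W (WithLp.toLp 2 y)) := by
    rw [toLpLin_apply, EuclideanSpace.inner_eq_star_dotProduct]
    simp [dotProduct_comm]
  rw [h1, ← hn, ← hn]
  calc _ ≤ _ := real_inner_le_norm _ _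
    _ ≤ ‖WithLp.toLp 2 x‖ * (opNorm W * ‖WithLp.toLp 2 y‖) := by
      gcongr; exact norm_toEuclideanLin_le _ _
    _ = _ := by ring

theorem nucNorm_vecMulVec_le (x y : V → ℝ) :
    nucNorm (vecMulVec x y) ≤ √(x ⬝ᵥ x) * √(y ⬝ᵥ y) := by
  obtain ⟨W, hW, h⟩ := exists_dual_certificate (vecMulVec x y)
  rw [← h, traceInner_vecMulVec]
  refine (dotProduct_mulVec_le W x y).trans ?_
  exact mul_le_of_le_one_left (by positivity) hW

/-! ### Decomposition along the model space -/

theorem norm_sq_eq_of_isSelfAdjoint_of_isIdempotentElem {E : Type*} [NormedAddCommGroup E]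
    [InnerProductSpace ℝ E] [CompleteSpace E] {p : E →L[ℝ] E} (hs : IsSelfAdjoint p)
    (hp : IsIdempotentElem p) (x y : E) :
    ‖p x + (y - p y)‖ ^ 2 = ‖p x‖ ^ 2 + ‖y - p y‖ ^ 2 := by
  have hsym : ∀ x y, inner ℝ (p x) y = inner ℝ x (p y) := fun x y => by
    rw [← ContinuousLinearMap.adjoint_inner_right, ← ContinuousLinearMap.star_eq_adjoint, hs.star_eq]
  have hpp : p (p y) = p y := congr($hp y)
  have h0 : inner ℝ (p x) (y - p y) = 0 := by
    rw [hsym, map_sub, hpp, sub_self, inner_zero_right]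
  rw [sq, sq, sq]
  exact norm_add_sq_eq_norm_sq_add_norm_sq_of_inner_eq_zero _ _ h0

/-- A block-diagonal operator, equal to the identity on the range of an orthogonal projection and
to the compression of a contraction on its kernel, is a contraction. -/
theorem norm_add_compression_le_one {E : Type*} [NormedAddCommGroup E]
    [InnerProductSpace ℝ E] [CompleteSpace E] {p w : E →L[ℝ] E} (hs : IsSelfAdjoint p)
    (hp : IsIdempotentElem p) (hw : ‖w‖ ≤ 1) : ‖p + (1 - p) * w * (1 - p)‖ ≤ 1 := by
  refine ContinuousLinearMap.opNorm_le_bound _ zero_le_one fun x => ?_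
  rw [one_mul]
  refine le_of_sq_le_sq ?_ (norm_nonneg _)
  have key := norm_sq_eq_of_isSelfAdjoint_of_isIdempotentElem hs hp
  set y := w (x - p x) with hy
  have e1 : (p + (1 - p) * w * (1 - p)) x = p x + (y - p y) := by simp [hy]
  have e2 : ‖x‖ ^ 2 = ‖p x‖ ^ 2 + ‖x - p x‖ ^ 2 := by
    rw [← key]; simp
  have e3 : ‖y‖ ^ 2 = ‖p y‖ ^ 2 + ‖y - p y‖ ^ 2 := by
    rw [← key]; simp
  have e4 : ‖y‖ ≤ ‖x - p x‖ := by
    refine (w.le_opNorm _).trans ?_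
    exact mul_le_of_le_one_left (norm_nonneg _) hw
  have e5 := pow_le_pow_left₀ (norm_nonneg y) e4 2
  rw [e1, key, e2]
  nlinarith [sq_nonneg ‖p y‖]

theorem opNorm_add_compression_le_one {U W : Matrix V V ℝ} (hs : Uᵀ = U) (hU : U * U = U)
    (hW : opNorm W ≤ 1) : opNorm (U + (1 - U) * W * (1 - U)) ≤ 1 := by
  unfold opNorm at *
  rw [map_add, map_mul, map_mul, map_sub, map_one]
  refine norm_add_compression_le_one ?_ ?_ hW
  · rw [IsSelfAdjoint, ← map_star, star_eq_conjTranspose, conjTranspose_eq_transpose_of_trivial, hs]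
  · rw [IsIdempotentElem, ← map_mul, hU]

theorem opNorm_zero : opNorm (0 : Matrix V V ℝ) = 0 := by simp [opNorm]

theorem opNorm_neg (W : Matrix V V ℝ) : opNorm (-W) = opNorm W := by simp [opNorm]

/-- Every matrix `Δ` splits into a part `A` in the model space, which is a sum of three pairwise
orthogonal matrices of rank at most one with Frobenius norms `|α|`, `a`, `b`, and an orthogonal part
`B`. Only the component of `A` along `Θ*`, of size `α`, can lower the nuclear norm to first order:
the subgradient `u uᵀ + (1 - u uᵀ) W (1 - u uᵀ)` of the nuclear norm at `Θ*`, with `u` the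
normalization of `s` and `W` a dual certificate of `B`, gives the last inequality. -/
theorem exists_model_decomposition (s : V → ℝ) (Δ : Matrix V V ℝ) :
    ∃ A ∈ modelSpace s, ∃ B ∈ modelSpacePerp s, ∃ α a b : ℝ, 0 ≤ a ∧ 0 ≤ b ∧ Δ = A + B ∧
      nucNorm A ≤ |α| + a + b ∧ |α| ≤ nucNorm A ∧ α ^ 2 + a ^ 2 + b ^ 2 ≤ ‖Δ‖ ^ 2 ∧
      nucNorm (trueParam s) + α + nucNorm B ≤ nucNorm (trueParam s + Δ) := by
  -- For `s = 0` the normalized vector `u` is `0`, and all identities below persist.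
  set ρ : ℝ := √(s ⬝ᵥ s) with hρ
  set u : V → ℝ := ρ⁻¹ • s with hu
  have hss : 0 ≤ s ⬝ᵥ s := Finset.sum_nonneg fun i _ => mul_self_nonneg _
  have hρs : ρ ^ 2 = s ⬝ᵥ s := Real.sq_sqrt hss
  have hcases : (u ⬝ᵥ u = 1 ∧ ρ ≠ 0) ∨ (u = 0 ∧ s = 0) := by
    rcases eq_or_ne ρ 0 with h | h
    · right
      refine ⟨by simp [hu, h], ?_⟩
      rw [h] at hρs
      exact dotProduct_self_eq_zero.mp (by rw [← hρs]; simp)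
    · left
      refine ⟨?_, h⟩
      rw [hu, smul_dotProduct, dotProduct_smul, ← hρs]
      simp only [smul_eq_mul]
      field_simp
  have hsu : s = ρ • u := by
    rcases hcases with ⟨-, h⟩ | ⟨h1, h2⟩
    · rw [hu, smul_smul, mul_inv_cancel₀ h, one_smul]
    · rw [h1, h2]; simp
  have hqu : (u ⬝ᵥ u) • u = u := by
    rcases hcases with ⟨h, -⟩ | ⟨h, -⟩ <;> simp [h]
  set U : Matrix V V ℝ := vecMulVec u u with hU
  have hUt : Uᵀ = U := by rw [hU, transpose_vecMulVec]
  have hUU : U * U = U := by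
    rw [hU, vecMulVec_mul_vecMulVec, hqu]
  have hUu : U *ᵥ u = u := by
    rw [hU, vecMulVec_mulVec]; simpa using hqu
  have hUs : U *ᵥ s = s := by rw [hsu, mulVec_smul, hUu]
  have hPs : (1 - U) *ᵥ s = 0 := by rw [sub_mulVec, one_mulVec, hUs, sub_self]
  have hPt : (1 - U)ᵀ = 1 - U := by rw [transpose_sub, transpose_one, hUt]
  have hUP : U * (1 - U) = 0 := by rw [mul_sub, mul_one, hUU, sub_self]
  set α : ℝ := u ⬝ᵥ Δ *ᵥ u with hα
  set c : V → ℝ := Δᵀ *ᵥ u - α • u with hc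
  set d : V → ℝ := Δ *ᵥ u - α • u with hd
  set B : Matrix V V ℝ := (1 - U) * Δ * (1 - U) with hB
  set A : Matrix V V ℝ := α • U + vecMulVec u c + vecMulVec d u with hA
  have hUΔ : U * Δ = vecMulVec u (Δᵀ *ᵥ u) := by
    rw [hU, vecMulVec_mul, mulVec_transpose]
  have hΔU : Δ * U = vecMulVec (Δ *ᵥ u) u := by
    rw [hU, mul_vecMulVec]
  have hUΔU : U * Δ * U = α • U := by
    rw [mul_assoc, hΔU, hU, vecMulVec_mul_vecMulVec, ← hα]
    ext i j
    simp [vecMulVec_apply]; ring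
  have hAB : Δ = A + B := by
    have h1 : vecMulVec u c = U * Δ - α • U := by
      rw [hUΔ, hc, hU, vecMulVec_sub, vecMulVec_smul]
    have h2 : vecMulVec d u = Δ * U - α • U := by
      rw [hΔU, hd, hU, sub_vecMulVec, smul_vecMulVec]
    rw [hA, h1, h2, hB, ← hUΔU]
    noncomm_ring
  have hBs : B *ᵥ s = 0 := by
    rw [hB, ← mulVec_mulVec, hPs, mulVec_zero]
  have hsB : ∀ x, s ⬝ᵥ B *ᵥ x = 0 := fun x => by
    have h0 : s ᵥ* (1 - U) = 0 := by rw [← mulVec_transpose, hPt, hPs]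
    rw [dotProduct_mulVec, hB, mul_assoc, ← vecMul_vecMul, h0, zero_vecMul, zero_dotProduct]
  have hAmem : A ∈ modelSpace s := by
    rcases hcases with ⟨-, h⟩ | ⟨h, -⟩
    · refine ⟨ρ⁻¹ • (α • u + c), ρ⁻¹ • d, ?_⟩
      rw [vecMulVec_smul, smul_vecMulVec, ← smul_vecMulVec, ← vecMulVec_smul, ← hu, vecMulVec_add,
        vecMulVec_smul]
    · refine ⟨0, 0, ?_⟩
      rw [hA, hU, h]; simp
  have hBmem : B ∈ modelSpacePerp s := by
    rintro _ ⟨x, y, rfl⟩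
    rw [traceInner_comm, traceInner_add_right, traceInner_vecMulVec, traceInner_vecMulVec, hBs, hsB]
    simp
  have hUnorm : opNorm U ≤ 1 := by
    have := opNorm_add_compression_le_one hUt hUU (W := 0) (by rw [opNorm_zero]; exact zero_le_one)
    simpa using this
  have hUα : traceInner U Δ = α := by
    rw [hU, traceInner_comm, traceInner_vecMulVec]
  have hUB : traceInner U B = 0 := by
    rw [traceInner, hUt, hB, ← mul_assoc, ← mul_assoc, hUP]; simp
  have hUA : traceInner U A = α := by
    rw [hAB, traceInner_add_right, hUB, add_zero] at hUα
    exact hUα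
  have hsq : ∀ z : V → ℝ, 0 ≤ z ⬝ᵥ z := fun z => Finset.sum_nonneg fun i _ => mul_self_nonneg _
  have huc : u ⬝ᵥ c = 0 := by
    rw [hc, dotProduct_sub, dotProduct_smul, mulVec_transpose, ← dotProduct_comm,
      ← dotProduct_mulVec, ← hα]
    rcases hcases with ⟨h, -⟩ | ⟨h, -⟩
    · simp [h]
    · simp [hα, h]
  have hud : u ⬝ᵥ d = 0 := by
    rw [hd, dotProduct_sub, dotProduct_smul, ← hα]
    rcases hcases with ⟨h, -⟩ | ⟨h, -⟩
    · simp [h]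
    · simp [hα, h]
  have hUle : √(u ⬝ᵥ u) ≤ 1 := by
    rcases hcases with ⟨h, -⟩ | ⟨h, -⟩ <;> simp [h]
  refine ⟨A, hAmem, B, hBmem, α, √(c ⬝ᵥ c), √(d ⬝ᵥ d), Real.sqrt_nonneg _, Real.sqrt_nonneg _,
    hAB, ?_, ?_, ?_, ?_⟩
  · have h1 : nucNorm (α • U) ≤ |α| := by
      rw [hU, ← smul_vecMulVec]
      refine (nucNorm_vecMulVec_le _ _).trans ?_
      rw [smul_dotProduct, dotProduct_smul, smul_smul, smul_eq_mul, Real.sqrt_mul (mul_self_nonneg _),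
        Real.sqrt_mul_self_eq_abs]
      have := Real.sqrt_nonneg (u ⬝ᵥ u)
      calc |α| * √(u ⬝ᵥ u) * √(u ⬝ᵥ u) ≤ |α| * 1 * 1 := by gcongr
        _ = |α| := by ring
    have h2 : nucNorm (vecMulVec u c) ≤ √(c ⬝ᵥ c) :=
      (nucNorm_vecMulVec_le _ _).trans (mul_le_of_le_one_left (Real.sqrt_nonneg _) hUle)
    have h3 : nucNorm (vecMulVec d u) ≤ √(d ⬝ᵥ d) :=
      (nucNorm_vecMulVec_le _ _).trans (mul_le_of_le_one_right (Real.sqrt_nonneg _) hUle)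
    have h4 := nucNorm_add_le (α • U + vecMulVec u c) (vecMulVec d u)
    have h5 := nucNorm_add_le (α • U) (vecMulVec u c)
    linarith
  · have hn := nucNorm_nonneg A
    refine abs_le'.mpr ⟨?_, ?_⟩
    · rw [← hUA]
      exact (traceInner_le_opNorm_mul_nucNorm _ _).trans (mul_le_of_le_one_left hn hUnorm)
    · rw [← hUA, ← neg_one_mul, ← traceInner_smul_left, neg_one_smul]
      refine (traceInner_le_opNorm_mul_nucNorm _ _).trans (mul_le_of_le_one_left hn ?_)
      rwa [opNorm_neg]
  · have hABz : traceInner A B = 0 := hBmem A hAmem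
    have hΔ : ‖Δ‖ ^ 2 = ‖A‖ ^ 2 + ‖B‖ ^ 2 := by
      rw [hAB, ← traceInner_self, ← traceInner_self, ← traceInner_self, traceInner_add_right (A + B),
        traceInner_add_left A B A, traceInner_add_left A B B, traceInner_comm B A, hABz, add_zero,
        zero_add]
    have hAn : ‖A‖ ^ 2 = α ^ 2 + c ⬝ᵥ c + d ⬝ᵥ d := by
      rcases hcases with ⟨h, -⟩ | ⟨h, -⟩
      · rw [← traceInner_self, hA, hU]
        simp only [traceInner_add_right, traceInner_smul_right, traceInner_vecMulVec, add_mulVec,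
          smul_mulVec, vecMulVec_mulVec, dotProduct_add, dotProduct_smul, h, huc, hud,
          dotProduct_comm d u, dotProduct_comm c u, MulOpposite.smul_eq_mul_unop,
          MulOpposite.unop_op, smul_eq_mul]
        ring
      · have hα0 : α = 0 := by simp [hα, h]
        have hc0 : c = 0 := by simp [hc, h]
        have hd0 : d = 0 := by simp [hd, h]
        simp [hA, hα0, hc0, hd0]
    rw [hΔ, hAn, Real.sq_sqrt (hsq _), Real.sq_sqrt (hsq _)]
    have := sq_nonneg ‖B‖
    linarith
  · obtain ⟨W, hW, hWB⟩ := exists_dual_certificate B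
    have hle := traceInner_le_opNorm_mul_nucNorm (U + (1 - U) * W * (1 - U)) (trueParam s + Δ)
    have h1 : nucNorm (trueParam s) ≤ s ⬝ᵥ s :=
      (nucNorm_vecMulVec_le s s).trans (Real.mul_self_sqrt hss).le
    have h2 : traceInner (U + (1 - U) * W * (1 - U)) (trueParam s) = s ⬝ᵥ s := by
      rw [trueParam, traceInner_vecMulVec, add_mulVec, hUs, ← mulVec_mulVec, hPs]
      simp
    have h3 : traceInner ((1 - U) * W * (1 - U)) Δ = traceInner W B := by
      rw [traceInner, traceInner, transpose_mul, transpose_mul, hPt, hB, mul_assoc, trace_mul_comm]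
      congr 1
      noncomm_ring
    rw [traceInner_add_right, h2, traceInner_add_left, h3, hUα, hWB] at hle
    have h4 := hle.trans (mul_le_of_le_one_left (nucNorm_nonneg _)
      (opNorm_add_compression_le_one hUt hUU hW))
    linarith

/-! ### The deterministic error bound -/

theorem le_of_forall_le_add_mul {x e q : ℝ} (hq : 0 ≤ q)
    (h : ∀ u : ℝ, 0 < u → u < 1 → x ≤ e + u * q) : x ≤ e := by
  by_contra! hcon
  have hg : 0 < x - e := by linarith
  have hv : 0 < (x - e) / (2 * (q + 1)) := by positivity
  have h1 := h (min (1 / 2) ((x - e) / (2 * (q + 1)))) (lt_min (by norm_num) hv)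
    ((min_le_left _ _).trans_lt (by norm_num))
  have h2 : min (1 / 2) ((x - e) / (2 * (q + 1))) * q ≤ (x - e) / (2 * (q + 1)) * (q + 1) :=
    mul_le_mul (min_le_right _ _) (by linarith) hq hv.le
  have h3 : (x - e) / (2 * (q + 1)) * (q + 1) = (x - e) / 2 := by field_simp
  linarith

/-- First-order optimality of the estimator, tested in the direction of the true parameter. -/
theorem IsEstimator.sum_sq_le {T₁ : ℕ} (hT₁ : 0 < T₁) {S : Submodule ℝ (Matrix V V ℝ)}
    {X : Fin T₁ → Matrix V V ℝ} {Θ₀ Θ : Matrix V V ℝ} {ε : Fin T₁ → ℝ} {lam : ℝ} (hlam : 0 ≤ lam)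
    (hΘ₀ : Θ₀ ∈ S)
    (h : IsEstimator S X (fun t => traceInner Θ₀ (X t) + ε t) lam Θ) :
    (∑ t, traceInner (X t) (Θ - Θ₀) ^ 2) / T₁ ≤
      traceInner (∑ t, ε t • X t) (Θ - Θ₀) / T₁ + lam * (nucNorm Θ₀ - nucNorm Θ) := by
  obtain ⟨hΘ, hmin⟩ := h
  have hT : (0 : ℝ) < T₁ := Nat.cast_pos.mpr hT₁
  set D := Θ - Θ₀ with hD
  set Q := ∑ t, traceInner (X t) D ^ 2 with hQ
  have hN : traceInner (∑ t, ε t • X t) D = ∑ t, ε t * traceInner (X t) D := by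
    rw [traceInner, transpose_sum, Finset.sum_mul, trace_sum]
    exact Finset.sum_congr rfl fun t _ => traceInner_smul_left _ _ _
  set N := traceInner (∑ t, ε t • X t) D with hNdef
  have hQ0 : 0 ≤ Q := Finset.sum_nonneg fun _ _ => sq_nonneg _
  have hobj : ∀ r : ℝ, ∑ t, ((traceInner Θ₀ (X t) + ε t) - traceInner (X t) (Θ₀ + r • D)) ^ 2
      = (∑ t, ε t ^ 2) - 2 * r * N + r ^ 2 * Q := by
    intro r
    rw [hN, hQ, Finset.mul_sum, Finset.mul_sum, ← Finset.sum_sub_distrib, ← Finset.sum_add_distrib]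
    refine Finset.sum_congr rfl fun t _ => ?_
    rw [traceInner_add_right, traceInner_smul_right, traceInner_comm Θ₀]
    ring
  -- Compare `Θ` with `Θ₀ + (1 - u) • D`, divide by `u`, and let `u` tend to `0`.
  have hstep : ∀ u : ℝ, 0 < u → u < 1 →
      Q / T₁ ≤ N / T₁ + lam * (nucNorm Θ₀ - nucNorm Θ) + u * (Q / (2 * T₁)) := by
    intro u hu0 hu1
    have hmem : Θ₀ + (1 - u) • D ∈ S := S.add_mem hΘ₀ (S.smul_mem _ (S.sub_mem hΘ hΘ₀))
    have hle : objective X (fun t => traceInner Θ₀ (X t) + ε t) lam Θ ≤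
        objective X (fun t => traceInner Θ₀ (X t) + ε t) lam (Θ₀ + (1 - u) • D) := hmin hmem
    have hΘe : Θ = Θ₀ + (1 : ℝ) • D := by rw [hD]; simp
    have h1 := hobj 1
    rw [← hΘe] at h1
    unfold objective at hle
    rw [h1, hobj] at hle
    have hconv : nucNorm (Θ₀ + (1 - u) • D) ≤ (1 - u) * nucNorm Θ + u * nucNorm Θ₀ := by
      have he : Θ₀ + (1 - u) • D = (1 - u) • Θ + u • Θ₀ := by
        rw [hD, smul_sub, sub_smul, sub_smul, one_smul, one_smul]; abel
      rw [he]
      exact (nucNorm_add_le _ _).trans (add_le_add (nucNorm_smul_le _ (by linarith))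
        (nucNorm_smul_le _ hu0.le))
    have hconv' := mul_le_mul_of_nonneg_left hconv hlam
    have h2 : u * (Q / T₁) ≤
        u * (N / T₁ + lam * (nucNorm Θ₀ - nucNorm Θ) + u * (Q / (2 * T₁))) := by
      have e1 : 1 / (2 * (T₁ : ℝ)) * ((∑ t, ε t ^ 2) - 2 * 1 * N + 1 ^ 2 * Q) -
          1 / (2 * (T₁ : ℝ)) * ((∑ t, ε t ^ 2) - 2 * (1 - u) * N + (1 - u) ^ 2 * Q) =
          u * (Q / T₁) - u * (N / T₁) - u * (u * (Q / (2 * T₁))) := by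
        field_simp
        ring
      linarith
    exact le_of_mul_le_mul_left h2 hu0
  exact le_of_forall_le_add_mul (div_nonneg hQ0 (by linarith)) hstep

/-- The scalar optimization behind the constant of the error bound: the right-hand side of `h` is
convex in the nuclear norm `p` of the off-model part, so it is largest at an endpoint of the
interval `[0, 2 |α| + m]`. -/
theorem sq_error_le {κ lam α a b m p F : ℝ} (hκ : 0 < κ) (hlam : 0 ≤ lam)
    (ha : 0 ≤ a) (hb : 0 ≤ b) (hm0 : 0 ≤ m) (hm : m ≤ |α| + a + b) (hp0 : 0 ≤ p)
    (hp : p ≤ 2 * |α| + m) (hF : α ^ 2 + a ^ 2 + b ^ 2 ≤ F ^ 2)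
    (h : 64 * (κ * F ^ 2) ≤ κ * (m + p) ^ 2 + 64 * (lam * (|α| + m / 2 - p / 2))) :
    κ ^ 2 * F ^ 2 ≤ 9 / 2 * lam ^ 2 := by
  rw [← sq_abs α] at hF
  have hx : 0 ≤ |α| := abs_nonneg α
  set x := |α|
  set M := x + a + b with hM
  set R := x + M / 2 with hR
  have hR0 : 0 ≤ R := by positivity
  have hpR : p ≤ 2 * R := by rw [hR]; linarith
  -- `θ` is the relative position of `p` in `[0, 2 R]`, an interval containing `[0, 2 |α| + m]`.
  obtain ⟨θ, hθ0, hθ1, hpθ⟩ : ∃ θ : ℝ, 0 ≤ θ ∧ θ ≤ 1 ∧ p = 2 * R * θ := by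
    rcases hR0.eq_or_lt with h0 | h0
    · exact ⟨0, le_rfl, zero_le_one, by rw [← h0] at hpR ⊢; linarith⟩
    · exact ⟨p / (2 * R), by positivity, (div_le_one (by positivity)).mpr hpR, by field_simp⟩
  have hM2 : M ^ 2 ≤ 3 * F ^ 2 := by
    rw [hM]; nlinarith [sq_nonneg (x - a), sq_nonneg (x - b), sq_nonneg (a - b)]
  have hR2 : R ^ 2 ≤ 11 / 4 * F ^ 2 := by
    rw [hR, hM]
    nlinarith [sq_nonneg (x - 3 * a), sq_nonneg (x - 3 * b), sq_nonneg (a - b)]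
  have hE2 : (M + 2 * R) ^ 2 ≤ 24 * F ^ 2 := by
    rw [hR, hM]
    nlinarith [sq_nonneg (x - 2 * a), sq_nonneg (x - 2 * b), sq_nonneg (a - b)]
  have hconv : (m + p) ^ 2 ≤ (1 - θ) * (3 * F ^ 2) + θ * (24 * F ^ 2) := by
    have h1 : (m + p) ^ 2 ≤ (M + p) ^ 2 := by gcongr
    have h2 : (M + p) ^ 2 ≤ (1 - θ) * M ^ 2 + θ * (M + 2 * R) ^ 2 := by
      rw [hpθ]
      nlinarith [mul_nonneg (mul_nonneg hθ0 (sub_nonneg.mpr hθ1)) (sq_nonneg (2 * R))]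
    have h3 := mul_le_mul_of_nonneg_left hM2 (sub_nonneg.mpr hθ1)
    have h4 := mul_le_mul_of_nonneg_left hE2 hθ0
    linarith
  have hlin : lam * (x + m / 2 - p / 2) ≤ lam * (R * (1 - θ)) := by
    refine mul_le_mul_of_nonneg_left ?_ hlam
    rw [hpθ, hR]; linarith
  have hκF : 0 ≤ κ * F ^ 2 := by positivity
  have hmain : κ * F ^ 2 * (61 - 21 * θ) ≤ 64 * (lam * R * (1 - θ)) := by
    have := mul_le_mul_of_nonneg_left hconv hκ.le
    nlinarith
  rcases hθ1.eq_or_lt with h1 | h1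
  · have h0 : κ * F ^ 2 ≤ 0 := by rw [h1] at hmain; linarith
    have h2 := mul_nonpos_of_nonneg_of_nonpos hκ.le h0
    linarith [sq_nonneg lam]
  · have h2 : 61 * (κ * F ^ 2) ≤ 64 * (lam * R) := by
      have h3 : (1 - θ) * (61 * (κ * F ^ 2)) ≤ (1 - θ) * (64 * (lam * R)) := by nlinarith
      exact le_of_mul_le_mul_left h3 (by linarith)
    rcases (sq_nonneg F).eq_or_lt with h0 | h0
    · rw [← h0, mul_zero]
      exact mul_nonneg (by norm_num) (sq_nonneg lam)
    · have h4 : (61 * (κ * F ^ 2)) ^ 2 ≤ (64 * (lam * R)) ^ 2 :=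
        pow_le_pow_left₀ (mul_nonneg (by norm_num) hκF) h2 2
      have h5 : (64 * (lam * R)) ^ 2 ≤ 4096 * lam ^ 2 * (11 / 4 * F ^ 2) := by
        have := mul_le_mul_of_nonneg_left hR2 (by positivity : 0 ≤ 4096 * lam ^ 2)
        linarith
      have h6 : F ^ 2 * (3721 * (κ ^ 2 * F ^ 2)) ≤ F ^ 2 * (11264 * lam ^ 2) := by linarith
      have h7 := le_of_mul_le_mul_left h6 h0
      linarith [sq_nonneg lam]

/-- The error bound on the event that the noise is dominated by the penalty level. -/
theorem IsEstimator.sq_norm_sub_le {T₁ : ℕ} (hT₁ : 0 < T₁) {S : Submodule ℝ (Matrix V V ℝ)}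
    {s : V → ℝ} {X : Fin T₁ → Matrix V V ℝ} {Θ : Matrix V V ℝ} {ε : Fin T₁ → ℝ} {lam κ τ : ℝ}
    (hlam : 0 < lam) (hκ : 0 < κ) (hκτ : 128 * τ ^ 2 ≤ κ) (hS : trueParam s ∈ S)
    (hRSC : RSC S s X κ τ) (hnoise : opNorm (∑ t, ε t • X t) ≤ T₁ * (lam / 2))
    (h : IsEstimator S X (fun t => traceInner (trueParam s) (X t) + ε t) lam Θ) :
    κ ^ 2 * ‖Θ - trueParam s‖ ^ 2 ≤ 9 / 2 * lam ^ 2 := by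
  have hT : (0 : ℝ) < T₁ := Nat.cast_pos.mpr hT₁
  have hopt := h.sum_sq_le hT₁ hlam.le hS
  have hΔS : Θ - trueParam s ∈ S := S.sub_mem h.1 hS
  have hΘ : trueParam s + (Θ - trueParam s) = Θ := by abel
  set Δ := Θ - trueParam s with hΔ
  obtain ⟨A, hA, B, hB, α, a, b, ha, hb, hAB, hAle, hαA, hsq, hdec⟩ :=
    exists_model_decomposition s Δ
  rw [hΘ] at hdec
  have hA0 := nucNorm_nonneg A
  have hB0 := nucNorm_nonneg B
  have hΔn : nucNorm Δ ≤ nucNorm A + nucNorm B := by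
    conv_lhs => rw [hAB]
    exact nucNorm_add_le A B
  have hN : traceInner (∑ t, ε t • X t) Δ / T₁ ≤ lam / 2 * (nucNorm A + nucNorm B) := by
    rw [div_le_iff₀ hT]
    refine (traceInner_le_opNorm_mul_nucNorm _ _).trans ?_
    calc opNorm (∑ t, ε t • X t) * nucNorm Δ
        ≤ T₁ * (lam / 2) * (nucNorm A + nucNorm B) :=
          mul_le_mul hnoise hΔn (nucNorm_nonneg _) (by positivity)
      _ = _ := by ring
  have hQ0 : 0 ≤ (∑ t, traceInner (X t) Δ ^ 2) / (T₁ : ℝ) :=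
    div_nonneg (Finset.sum_nonneg fun _ _ => sq_nonneg _) hT.le
  have hpen : lam * (nucNorm (trueParam s) - nucNorm Θ) ≤ lam * (|α| - nucNorm B) := by
    refine mul_le_mul_of_nonneg_left ?_ hlam.le
    have := neg_abs_le α
    linarith
  have hupper : (∑ t, traceInner (X t) Δ ^ 2) / (T₁ : ℝ) ≤
      lam * (|α| + nucNorm A / 2 - nucNorm B / 2) := by linarith
  -- Since `|α| ≤ ‖A‖`, this puts `Δ` into the cone.
  have hB2 : nucNorm B ≤ 2 * |α| + nucNorm A := by
    have := nonneg_of_mul_nonneg_right (hQ0.trans hupper) hlam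
    linarith
  have hR := hRSC Δ ⟨A, hA, B, hB, hAB, by linarith⟩ hΔS
  have e : 1 / (2 * (T₁ : ℝ)) * ∑ t, traceInner (X t) Δ ^ 2 =
      (∑ t, traceInner (X t) Δ ^ 2) / (T₁ : ℝ) / 2 := by field_simp
  rw [e] at hR
  refine sq_error_le hκ hlam.le ha hb hA0 hAle hB0 hB2 hsq ?_
  have h1 : 128 * τ ^ 2 * nucNorm Δ ^ 2 ≤ κ * (nucNorm A + nucNorm B) ^ 2 := by
    exact mul_le_mul hκτ (pow_le_pow_left₀ (nucNorm_nonneg _) hΔn 2) (sq_nonneg _) hκ.le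
  linarith

/-! ### Moments of random series of contractions -/

open MeasureTheory ProbabilityTheory
open scoped ENNReal

section Moments

variable {ι E : Type*} [Fintype ι] [NormedAddCommGroup E] [InnerProductSpace ℝ E]

theorem prod_pow_add_single [DecidableEq ι] (y : ι → ℝ) (m : ι → ℕ) (t : ι) :
    ∏ i, y i ^ (m + Pi.single t 1 : ι → ℕ) i = (∏ i, y i ^ m i) * y t := by
  simp only [Pi.add_apply, pow_add, Finset.prod_mul_distrib]
  congr 1
  rw [Finset.prod_eq_single t (fun i _ hi => by simp [Pi.single_eq_of_ne hi]) (by simp)]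
  simp

/-- Comparison of moments. When all mixed moments of `y` are nonnegative, the moments of the
operator `∑ t, y t • X t` with contractions `X t` are dominated by those of the scalar `∑ t, y t`:
expand the power into words, each of which is a contraction. The extra monomial `∏ i, y i ^ m i`
makes the statement inductive. -/
theorem abs_integral_inner_sum_smul_pow_le {μ : Measure (ι → ℝ)} {X : ι → E →L[ℝ] E}
    (hint : ∀ m : ι → ℕ, Integrable (fun y : ι → ℝ => ∏ i, y i ^ m i) μ)
    (hpos : ∀ m : ι → ℕ, 0 ≤ ∫ y, ∏ i, y i ^ m i ∂μ) (hX : ∀ t, ‖X t‖ ≤ 1) (n : ℕ) :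
    ∀ (m : ι → ℕ) (x z : E),
      Integrable (fun y => (∏ i, y i ^ m i) * inner ℝ x (((∑ t, y t • X t) ^ n) z)) μ ∧
      Integrable (fun y => (∏ i, y i ^ m i) * (∑ t, y t) ^ n) μ ∧
      0 ≤ ∫ y, (∏ i, y i ^ m i) * (∑ t, y t) ^ n ∂μ ∧
      |∫ y, (∏ i, y i ^ m i) * inner ℝ x (((∑ t, y t • X t) ^ n) z) ∂μ| ≤
        ‖x‖ * ‖z‖ * ∫ y, (∏ i, y i ^ m i) * (∑ t, y t) ^ n ∂μ := by
  classical
  induction n with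
  | zero =>
    intro m x z
    simp only [pow_zero, mul_one, one_apply_eq_self]
    refine ⟨(hint m).mul_const _, hint m, hpos m, ?_⟩
    rw [integral_mul_const, abs_mul, abs_of_nonneg (hpos m), mul_comm]
    exact mul_le_mul_of_nonneg_right (abs_real_inner_le_norm x z) (hpos m)
  | succ n ih =>
    intro m x z
    have e1 : ∀ y : ι → ℝ, (∏ i, y i ^ m i) * inner ℝ x (((∑ t, y t • X t) ^ (n + 1)) z) =
        ∑ t, (∏ i, y i ^ (m + Pi.single t 1 : ι → ℕ) i) *
          inner ℝ x (((∑ t, y t • X t) ^ n) (X t z)) := by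
      intro y
      rw [pow_succ, mul_apply_eq_comp]
      have e0 : (∑ t, y t • X t) z = ∑ t, y t • X t z := by simp
      rw [e0, map_sum, inner_sum, Finset.mul_sum]
      refine Finset.sum_congr rfl fun t _ => ?_
      rw [map_smul, inner_smul_right, prod_pow_add_single]
      ring
    have e2 : ∀ y : ι → ℝ, (∏ i, y i ^ m i) * (∑ t, y t) ^ (n + 1) =
        ∑ t, (∏ i, y i ^ (m + Pi.single t 1 : ι → ℕ) i) * (∑ t, y t) ^ n := by
      intro y
      rw [pow_succ, ← mul_assoc, Finset.mul_sum]
      refine Finset.sum_congr rfl fun t _ => ?_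
      rw [prod_pow_add_single]
      ring
    simp only [e1, e2]
    have h t := ih (m + Pi.single t 1) x (X t z)
    refine ⟨integrable_finsetSum _ fun t _ => (h t).1,
      integrable_finsetSum _ fun t _ => (h t).2.1, ?_, ?_⟩
    · rw [integral_finsetSum _ fun t _ => (h t).2.1]
      exact Finset.sum_nonneg fun t _ => (h t).2.2.1
    · rw [integral_finsetSum _ fun t _ => (h t).2.1, integral_finsetSum _ fun t _ => (h t).1,
        Finset.mul_sum]
      refine (Finset.abs_sum_le_sum_abs _ _).trans (Finset.sum_le_sum fun t _ => ?_)
      refine (h t).2.2.2.trans (mul_le_mul_of_nonneg_right ?_ (h t).2.2.1)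
      refine mul_le_mul_of_nonneg_left ?_ (norm_nonneg _)
      exact ((X t).le_opNorm z).trans (mul_le_of_le_one_left (norm_nonneg _) (hX t))

theorem continuous_norm_sum_smul (X : ι → E →L[ℝ] E) :
    Continuous fun y : ι → ℝ => ‖∑ t, y t • X t‖ :=
  (continuous_finsetSum _ fun t _ => (continuous_apply t).smul continuous_const).norm

theorem measurable_cosh_norm_sum_smul (X : ι → E →L[ℝ] E) (θ : ℝ) :
    Measurable fun y : ι → ℝ => ENNReal.ofReal (Real.cosh (θ * ‖∑ t, y t • X t‖)) :=
  (Real.continuous_cosh.comp ((continuous_norm_sum_smul X).const_mul θ)).measurable.ennreal_ofReal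

end Moments

/-! ### The operator norm and the trace of powers -/

theorem norm_le_sqrt_sum_sq {ι E : Type*} [Fintype ι] [NormedAddCommGroup E]
    [InnerProductSpace ℝ E] (b : OrthonormalBasis ι ℝ E) (A : E →L[ℝ] E) :
    ‖A‖ ≤ √(∑ i, ‖A (b i)‖ ^ 2) := by
  refine ContinuousLinearMap.opNorm_le_bound _ (Real.sqrt_nonneg _) fun x => ?_
  conv_lhs => rw [← b.sum_repr x]
  rw [map_sum, mul_comm]
  refine (norm_sum_le _ _).trans ?_
  have h1 : ‖x‖ = √(∑ i, ‖b.repr x i‖ ^ 2) := by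
    rw [← Real.sqrt_sq (norm_nonneg x), ← b.sum_sq_norm_inner_right x]
    simp only [b.repr_apply_apply]
  rw [h1]
  refine le_trans (le_of_eq ?_) (Real.sum_mul_le_sqrt_mul_sqrt _ _ _)
  exact Finset.sum_congr rfl fun i _ => by rw [map_smul, norm_smul]

theorem norm_pow_le_norm_pow_of_isSelfAdjoint {A : Type*} [NormedRing A] [StarRing A] [CStarRing A]
    [NormOneClass A] {a : A} (ha : IsSelfAdjoint a) (k : ℕ) : ‖a‖ ^ k ≤ ‖a ^ k‖ := by
  rcases (norm_nonneg a).eq_or_lt with h0 | h0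
  · rcases k with _ | k
    · simp
    · rw [← h0]; simp
  · -- The C⋆-identity gives equality for the exponent `2 ^ k`; split off the factor `a ^ k`.
    have hk : k ≤ 2 ^ k := Nat.lt_two_pow_self.le
    have h1 : ‖a‖ ^ k * ‖a‖ ^ (2 ^ k - k) ≤ ‖a ^ k‖ * ‖a‖ ^ (2 ^ k - k) := by
      rw [← pow_add, Nat.add_sub_cancel' hk, ← ha.norm_pow_two_pow]
      calc ‖a ^ 2 ^ k‖ = ‖a ^ k * a ^ (2 ^ k - k)‖ := by rw [← pow_add, Nat.add_sub_cancel' hk]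
        _ ≤ ‖a ^ k‖ * ‖a ^ (2 ^ k - k)‖ := norm_mul_le _ _
        _ ≤ _ := by gcongr; exact norm_pow_le _ _
    exact le_of_mul_le_mul_right h1 (by positivity)

/-- The trace of an even power bounds the same power of the operator norm. -/
theorem norm_pow_le_sum_inner_pow {ι E : Type*} [Fintype ι] [NormedAddCommGroup E]
    [InnerProductSpace ℝ E] [CompleteSpace E] [Nontrivial E] (b : OrthonormalBasis ι ℝ E)
    {A : E →L[ℝ] E} (hA : IsSelfAdjoint A) (k : ℕ) :
    ‖A‖ ^ (2 * k) ≤ ∑ i, inner ℝ (b i) ((A ^ (2 * k)) (b i)) := by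
  have h1 := (norm_pow_le_norm_pow_of_isSelfAdjoint hA k).trans (norm_le_sqrt_sum_sq b (A ^ k))
  have h2 := pow_le_pow_left₀ (by positivity) h1 2
  rw [Real.sq_sqrt (by positivity), ← pow_mul, mul_comm k 2] at h2
  refine h2.trans (le_of_eq (Finset.sum_congr rfl fun i _ => ?_))
  have h3 : (A ^ k).adjoint = A ^ k := by
    rw [← ContinuousLinearMap.star_eq_adjoint]; exact (hA.pow k).star_eq
  rw [two_mul, pow_add, mul_apply_eq_comp, ← real_inner_self_eq_norm_sq,
    ← ContinuousLinearMap.adjoint_inner_right, h3]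

/-! ### Gaussian series of self-adjoint contractions -/

theorem integral_pow_gaussianReal_nonneg (v : ℝ≥0) (k : ℕ) :
    0 ≤ ∫ x, x ^ k ∂gaussianReal 0 v := by
  rcases k.even_or_odd with hk | hk
  · exact integral_nonneg fun x => hk.pow_nonneg x
  · have h : ∫ x, x ^ k ∂gaussianReal 0 v = ∫ x, (-x) ^ k ∂gaussianReal 0 v := by
      conv_lhs => rw [← neg_zero, ← gaussianReal_map_neg]
      rw [integral_map (by fun_prop) (by fun_prop)]
    simp only [hk.neg_pow, integral_neg] at h
    linarith

theorem integrable_pow_gaussianReal (v : ℝ≥0) (k : ℕ) :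
    Integrable (fun x : ℝ => x ^ k) (gaussianReal 0 v) := by
  rcases eq_or_ne k 0 with rfl | hk
  · simp
  · have h := (memLp_id_gaussianReal (μ := 0) (v := v) k).integrable_norm_pow hk
    refine (integrable_norm_iff (by fun_prop)).mp (h.congr (ae_of_all _ fun x => ?_))
    simp

section Gaussian

variable {ι κ E : Type*} [Fintype ι] [Fintype κ] [NormedAddCommGroup E] [InnerProductSpace ℝ E]
  [CompleteSpace E] [Nontrivial E]

theorem integral_cosh_sum_gaussianReal (v : ℝ≥0) (θ : ℝ) :
    Integrable (fun y : ι → ℝ => Real.cosh (θ * ∑ t, y t))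
      (Measure.pi fun _ => gaussianReal 0 v) ∧
    ∫ y : ι → ℝ, Real.cosh (θ * ∑ t, y t) ∂Measure.pi (fun _ => gaussianReal 0 v) =
      Real.exp (Fintype.card ι * (v * θ ^ 2 / 2)) := by
  have hi : ∀ r : ℝ, Integrable (fun y : ι → ℝ => Real.exp (r * ∑ t, y t))
      (Measure.pi fun _ => gaussianReal 0 v) := fun r => by
    simp only [Finset.mul_sum, Real.exp_sum]
    exact Integrable.fintype_prod fun _ => integrable_exp_mul_gaussianReal r
  have hv : ∀ r : ℝ, ∫ y : ι → ℝ, Real.exp (r * ∑ t, y t)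
      ∂Measure.pi (fun _ => gaussianReal 0 v) = Real.exp (Fintype.card ι * (v * r ^ 2 / 2)) := by
    intro r
    simp only [Finset.mul_sum, Real.exp_sum]
    rw [integral_fintype_prod_eq_prod (fun _ x => Real.exp (r * x)), Finset.prod_const,
      Finset.card_univ]
    have := mgf_gaussianReal (p := gaussianReal 0 v) (X := id) Measure.map_id r
    rw [mgf] at this
    simp only [id] at this
    rw [this, ← Real.exp_nat_mul]
    simp
  have hc : ∀ y : ι → ℝ, Real.cosh (θ * ∑ t, y t) =
      (Real.exp (θ * ∑ t, y t) + Real.exp (-θ * ∑ t, y t)) / 2 := fun y => by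
    rw [Real.cosh_eq, neg_mul]
  simp only [hc]
  refine ⟨((hi θ).add (hi (-θ))).div_const 2, ?_⟩
  rw [integral_div, integral_add (hi θ) (hi (-θ)), hv, hv, neg_sq]
  ring

theorem ofReal_cosh_eq_tsum (θ r : ℝ) : ENNReal.ofReal (Real.cosh (θ * r)) =
    ∑' k : ℕ, ENNReal.ofReal (θ ^ (2 * k) / ((2 * k).factorial : ℝ) * r ^ (2 * k)) := by
  have e : ∀ k : ℕ, (θ * r) ^ (2 * k) / ((2 * k).factorial : ℝ) =
      θ ^ (2 * k) / ((2 * k).factorial : ℝ) * r ^ (2 * k) := fun k => by rw [mul_pow]; ring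
  have hs := Real.hasSum_cosh (θ * r)
  simp only [e] at hs
  rw [← hs.tsum_eq, ENNReal.ofReal_tsum_of_nonneg (fun k => ?_) hs.summable]
  rw [← e]
  exact div_nonneg ((even_two_mul k).pow_nonneg _) (Nat.cast_nonneg _)

theorem integrable_prod_pow_pi_gaussianReal (v : ℝ≥0) (m : ι → ℕ) :
    Integrable (fun y : ι → ℝ => ∏ i, y i ^ m i) (Measure.pi fun _ => gaussianReal 0 v) :=
  Integrable.fintype_prod (f := fun i x => x ^ m i) fun i => integrable_pow_gaussianReal v (m i)

theorem integral_prod_pow_pi_gaussianReal_nonneg (v : ℝ≥0) (m : ι → ℕ) :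
    0 ≤ ∫ y : ι → ℝ, ∏ i, y i ^ m i ∂Measure.pi (fun _ => gaussianReal 0 v) := by
  rw [integral_fintype_prod_eq_prod (fun i x => x ^ m i)]
  exact Finset.prod_nonneg fun i _ => integral_pow_gaussianReal_nonneg v (m i)

/-- The even moments of the norm of a self-adjoint series of contractions are at most those of
the scalar series, up to the dimension. -/
theorem lintegral_norm_sum_smul_pow_le {μ : Measure (ι → ℝ)} (b : OrthonormalBasis κ ℝ E)
    {X : ι → E →L[ℝ] E}
    (hint : ∀ m : ι → ℕ, Integrable (fun y : ι → ℝ => ∏ i, y i ^ m i) μ)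
    (hpos : ∀ m : ι → ℕ, 0 ≤ ∫ y, ∏ i, y i ^ m i ∂μ)
    (hX : ∀ t, ‖X t‖ ≤ 1) (hXs : ∀ t, IsSelfAdjoint (X t)) (k : ℕ) {c : ℝ} (hc : 0 ≤ c) :
    ∫⁻ y : ι → ℝ, ENNReal.ofReal (c * ‖∑ t, y t • X t‖ ^ (2 * k)) ∂μ ≤
      Fintype.card κ * ∫⁻ y : ι → ℝ, ENNReal.ofReal (c * (∑ t, y t) ^ (2 * k)) ∂μ := by
  have hmom : ∀ x z : E,
      Integrable (fun y => inner ℝ x (((∑ t, y t • X t) ^ (2 * k)) z)) μ ∧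
      Integrable (fun y : ι → ℝ => (∑ t, y t) ^ (2 * k)) μ ∧
      0 ≤ ∫ y : ι → ℝ, (∑ t, y t) ^ (2 * k) ∂μ ∧
      |∫ y, inner ℝ x (((∑ t, y t • X t) ^ (2 * k)) z) ∂μ| ≤
        ‖x‖ * ‖z‖ * ∫ y : ι → ℝ, (∑ t, y t) ^ (2 * k) ∂μ := fun x z => by
    simpa only [Pi.zero_apply, pow_zero, Finset.prod_const_one, one_mul] using
      abs_integral_inner_sum_smul_pow_le hint hpos hX (2 * k) 0 x z
  have hself : ∀ y : ι → ℝ, IsSelfAdjoint (∑ t, y t • X t) := fun y =>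
    isSelfAdjoint_sum _ fun t _ => IsSelfAdjoint.smul (IsSelfAdjoint.all (y t)) (hXs t)
  have hIs : Integrable (fun y : ι → ℝ => c * (∑ t, y t) ^ (2 * k)) μ :=
    ((hmom 0 0).2.1).const_mul _
  have hIt : Integrable (fun y : ι → ℝ => c *
      ∑ i, inner ℝ (b i) (((∑ t, y t • X t) ^ (2 * k)) (b i))) μ :=
    (integrable_finsetSum _ fun i _ => (hmom (b i) (b i)).1).const_mul _
  have hle : ∀ y : ι → ℝ, c * ‖∑ t, y t • X t‖ ^ (2 * k) ≤
      c * ∑ i, inner ℝ (b i) (((∑ t, y t • X t) ^ (2 * k)) (b i)) := fun y =>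
    mul_le_mul_of_nonneg_left (norm_pow_le_sum_inner_pow b (hself y) k) hc
  refine (lintegral_mono fun y => ENNReal.ofReal_le_ofReal (hle y)).trans ?_
  rw [← ofReal_integral_eq_lintegral_ofReal hIt (ae_of_all _ fun y =>
      (mul_nonneg hc (pow_nonneg (norm_nonneg _) _)).trans (hle y)),
    ← ofReal_integral_eq_lintegral_ofReal hIs (ae_of_all _ fun y =>
      mul_nonneg hc ((even_two_mul k).pow_nonneg _)),
    ← ENNReal.ofReal_natCast, ← ENNReal.ofReal_mul (Nat.cast_nonneg _)]
  refine ENNReal.ofReal_le_ofReal ?_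
  rw [integral_const_mul, integral_const_mul,
    integral_finsetSum _ fun i _ => (hmom (b i) (b i)).1, mul_left_comm]
  refine mul_le_mul_of_nonneg_left ?_ hc
  calc ∑ i, ∫ y, inner ℝ (b i) (((∑ t, y t • X t) ^ (2 * k)) (b i)) ∂μ
      ≤ ∑ i, ‖b i‖ * ‖b i‖ * ∫ y : ι → ℝ, (∑ t, y t) ^ (2 * k) ∂μ :=
        Finset.sum_le_sum fun i _ => (le_abs_self _).trans (hmom (b i) (b i)).2.2.2
    _ = Fintype.card κ * ∫ y : ι → ℝ, (∑ t, y t) ^ (2 * k) ∂μ := by simp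

/-- Exponential moments of the norm of a Gaussian series of self-adjoint contractions, from the
comparison of moments summed over the power series of the hyperbolic cosine. -/
theorem lintegral_cosh_norm_sum_smul_le (b : OrthonormalBasis κ ℝ E) {X : ι → E →L[ℝ] E}
    (hX : ∀ t, ‖X t‖ ≤ 1) (hXs : ∀ t, IsSelfAdjoint (X t)) (v : ℝ≥0) (θ : ℝ) :
    ∫⁻ y : ι → ℝ, ENNReal.ofReal (Real.cosh (θ * ‖∑ t, y t • X t‖))
        ∂Measure.pi (fun _ => gaussianReal 0 v) ≤
      ENNReal.ofReal (Fintype.card κ * Real.exp (Fintype.card ι * (v * θ ^ 2 / 2))) := by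
  simp only [ofReal_cosh_eq_tsum]
  have hmeas : ∀ k : ℕ, AEMeasurable (fun y : ι → ℝ => ENNReal.ofReal
      (θ ^ (2 * k) / ((2 * k).factorial : ℝ) * ‖∑ t, y t • X t‖ ^ (2 * k)))
      (Measure.pi fun _ => gaussianReal 0 v) := fun k =>
    (continuous_const.mul ((continuous_norm_sum_smul X).pow
      (2 * k))).measurable.ennreal_ofReal.aemeasurable
  rw [lintegral_tsum hmeas]
  refine (ENNReal.tsum_le_tsum fun k => lintegral_norm_sum_smul_pow_le b
    (integrable_prod_pow_pi_gaussianReal v) (integral_prod_pow_pi_gaussianReal_nonneg v) hX hXs k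
    (div_nonneg ((even_two_mul k).pow_nonneg θ) (Nat.cast_nonneg _))).trans ?_
  rw [ENNReal.tsum_mul_left, ← lintegral_tsum fun k => by fun_prop]
  simp only [← ofReal_cosh_eq_tsum]
  obtain ⟨hci, hcv⟩ := integral_cosh_sum_gaussianReal (ι := ι) v θ
  rw [← ofReal_integral_eq_lintegral_ofReal hci (ae_of_all _ fun y => (Real.cosh_pos _).le), hcv,
    ENNReal.ofReal_mul (Nat.cast_nonneg _), ENNReal.ofReal_natCast]

/-- Tail bound for a Gaussian series of self-adjoint contractions: Markov's inequality for
`cosh (θ * ‖·‖)`, where `θ` is the optimal parameter for the level `card ι * θ`. -/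
theorem measure_norm_sum_smul_gt_le (b : OrthonormalBasis κ ℝ E) {X : ι → E →L[ℝ] E}
    (hX : ∀ t, ‖X t‖ ≤ 1) (hXs : ∀ t, IsSelfAdjoint (X t)) {v : ℝ≥0} (hv : v ≤ 1) {θ : ℝ}
    (hθ : 0 ≤ θ) :
    Measure.pi (fun _ => gaussianReal 0 v)
        {y : ι → ℝ | Fintype.card ι * θ < ‖∑ t, y t • X t‖} ≤
      ENNReal.ofReal (2 * Fintype.card κ * Real.exp (-(Fintype.card ι * θ ^ 2 / 2))) := by
  set n : ℝ := ((Fintype.card ι : ℕ) : ℝ) with hn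
  have hn0 : 0 ≤ n := Nat.cast_nonneg _
  set c : ℝ := Real.exp (n * θ ^ 2) / 2 with hc
  have hc0 : 0 < c := by positivity
  have hsub : {y : ι → ℝ | n * θ < ‖∑ t, y t • X t‖} ⊆
      {y | ENNReal.ofReal c ≤ ENNReal.ofReal (Real.cosh (θ * ‖∑ t, y t • X t‖))} := by
    intro y hy
    refine ENNReal.ofReal_le_ofReal ?_
    have h1 : n * θ ^ 2 ≤ θ * ‖∑ t, y t • X t‖ := by
      have := mul_le_mul_of_nonneg_left (le_of_lt hy) hθ
      linarith
    rw [Real.cosh_eq, hc]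
    have h2 := Real.exp_le_exp.mpr h1
    have h3 := Real.exp_pos (-(θ * ‖∑ t, y t • X t‖))
    linarith
  have hmarkov := (mul_meas_ge_le_lintegral (μ := Measure.pi (fun _ : ι => gaussianReal 0 v))
    (f := fun y => ENNReal.ofReal (Real.cosh (θ * ‖∑ t, y t • X t‖)))
    (measurable_cosh_norm_sum_smul X θ)
    (ENNReal.ofReal c)).trans (lintegral_cosh_norm_sum_smul_le b hX hXs v θ)
  refine (measure_mono hsub).trans ?_
  have hcne : ENNReal.ofReal c ≠ 0 := by simpa using hc0
  rw [← ENNReal.mul_le_mul_iff_right hcne ENNReal.ofReal_ne_top]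
  refine hmarkov.trans ?_
  rw [← ENNReal.ofReal_mul hc0.le]
  refine ENNReal.ofReal_le_ofReal ?_
  have h1 : c * (2 * Fintype.card κ * Real.exp (-(n * θ ^ 2 / 2))) =
      Fintype.card κ * Real.exp (n * (1 * θ ^ 2 / 2)) := by
    have : Real.exp (n * (1 * θ ^ 2 / 2)) = Real.exp (n * θ ^ 2) * Real.exp (-(n * θ ^ 2 / 2)) := by
      rw [← Real.exp_add]; congr 1; ring
    rw [this, hc]; ring
  rw [h1]
  have hv' : (v : ℝ) ≤ 1 := hv
  gcongr

end Gaussian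
end OpinionBandit

/-! ### Forest matrices -/

namespace WeightedGraph

open Matrix

variable {V : Type*} [Fintype V] [DecidableEq V]

theorem dotProduct_laplacian_mulVec (G : WeightedGraph V) (x : V → ℝ) :
    x ⬝ᵥ G.laplacian *ᵥ x = (∑ i, ∑ j, G.weight i j * (x i - x j) ^ 2) / 2 := by
  have h1 : x ⬝ᵥ G.laplacian *ᵥ x =
      (∑ i, ∑ j, G.weight i j * x i ^ 2) - ∑ i, ∑ j, G.weight i j * (x i * x j) := by
    have hd : diagonal (fun i => ∑ j, G.weight i j) *ᵥ x = fun i => (∑ j, G.weight i j) * x i :=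
      funext fun i => mulVec_diagonal _ _ _
    rw [laplacian, sub_mulVec, dotProduct_sub, hd]
    simp only [dotProduct, mulVec, Finset.mul_sum, Finset.sum_mul]
    congr 1 <;> exact Finset.sum_congr rfl fun i _ => Finset.sum_congr rfl fun j _ => by ring
  have h2 : ∑ i, ∑ j, G.weight i j * x j ^ 2 = ∑ i, ∑ j, G.weight i j * x i ^ 2 := by
    rw [Finset.sum_comm]
    exact Finset.sum_congr rfl fun i _ => Finset.sum_congr rfl fun j _ => by rw [G.symm]
  have h3 : ∑ i, ∑ j, G.weight i j * (x i - x j) ^ 2 =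
      (∑ i, ∑ j, G.weight i j * x i ^ 2) - 2 * (∑ i, ∑ j, G.weight i j * (x i * x j)) +
        ∑ i, ∑ j, G.weight i j * x j ^ 2 := by
    simp only [Finset.mul_sum, ← Finset.sum_sub_distrib, ← Finset.sum_add_distrib]
    exact Finset.sum_congr rfl fun i _ => Finset.sum_congr rfl fun j _ => by ring
  rw [h1, h3, h2]
  ring

theorem dotProduct_self_le (G : WeightedGraph V) (x : V → ℝ) :
    x ⬝ᵥ x ≤ x ⬝ᵥ (1 + G.laplacian) *ᵥ x := by
  rw [add_mulVec, one_mulVec, dotProduct_add, dotProduct_laplacian_mulVec]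
  have : 0 ≤ ∑ i, ∑ j, G.weight i j * (x i - x j) ^ 2 :=
    Finset.sum_nonneg fun i _ => Finset.sum_nonneg fun j _ =>
      mul_nonneg (G.nonneg i j) (sq_nonneg _)
  linarith

theorem isUnit_det_one_add_laplacian (G : WeightedGraph V) : IsUnit (1 + G.laplacian).det := by
  rw [← isUnit_iff_isUnit_det, ← mulVec_injective_iff_isUnit]
  refine (injective_iff_map_eq_zero (1 + G.laplacian).mulVecLin).mpr fun x hx => ?_
  have h := G.dotProduct_self_le x
  rw [mulVecLin_apply] at hx
  rw [hx, dotProduct_zero] at h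
  exact dotProduct_self_eq_zero.mp
    (le_antisymm h (Finset.sum_nonneg fun i _ => mul_self_nonneg _))

theorem transpose_forestMatrix (G : WeightedGraph V) : G.forestMatrixᵀ = G.forestMatrix := by
  have h : G.weightᵀ = G.weight := by ext i j; exact G.symm j i
  rw [forestMatrix, transpose_nonsing_inv, transpose_add, transpose_one, laplacian, transpose_sub,
    diagonal_transpose, h]

/-- Forest matrices are contractions, since `(I + L) ≥ I`. -/
theorem opNorm_forestMatrix_le_one (G : WeightedGraph V) :
    OpinionBandit.opNorm G.forestMatrix ≤ 1 := by
  refine OpinionBandit.opNorm_le_of_forall zero_le_one fun y => ?_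
  set z := toEuclideanLin G.forestMatrix y with hz
  have h1 : (1 + G.laplacian) *ᵥ z.ofLp = y.ofLp := by
    rw [hz, ofLp_toLpLin, toLin'_apply, forestMatrix, mulVec_mulVec,
      mul_nonsing_inv _ G.isUnit_det_one_add_laplacian, one_mulVec]
  have h2 := G.dotProduct_self_le z.ofLp
  rw [h1] at h2
  have h3 : ‖z‖ ^ 2 ≤ ‖z‖ * ‖y‖ := by
    calc ‖z‖ ^ 2 = z.ofLp ⬝ᵥ z.ofLp := by
          rw [EuclideanSpace.real_norm_sq_eq]; simp [dotProduct, sq]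
      _ ≤ z.ofLp ⬝ᵥ y.ofLp := h2
      _ = inner ℝ z y := by
          rw [EuclideanSpace.inner_eq_star_dotProduct, dotProduct_comm]; simp
      _ ≤ ‖z‖ * ‖y‖ := real_inner_le_norm _ _
  rw [one_mul]
  rcases (norm_nonneg z).eq_or_lt with h0 | h0
  · rw [← h0]; exact norm_nonneg _
  · rw [sq] at h3
    exact le_of_mul_le_mul_left h3 h0

end WeightedGraph

/-! ### The noise event and conditioning -/

namespace OpinionBandit

open MeasureTheory ProbabilityTheory Matrix
open scoped ENNReal

section

variable {V : Type*} [Fintype V] [DecidableEq V]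

theorem measure_opNorm_sum_smul_gt_le [Nonempty V] {ι : Type*} [Fintype ι] {X : ι → Matrix V V ℝ}
    (hX : ∀ t, opNorm (X t) ≤ 1) (hXs : ∀ t, (X t)ᵀ = X t) {v : ℝ≥0} (hv : v ≤ 1) {θ : ℝ}
    (hθ : 0 ≤ θ) :
    Measure.pi (fun _ => gaussianReal 0 v)
        {y : ι → ℝ | Fintype.card ι * θ < opNorm (∑ t, y t • X t)} ≤
      ENNReal.ofReal (2 * Fintype.card V * Real.exp (-(Fintype.card ι * θ ^ 2 / 2))) := by
  have : Nontrivial (EuclideanSpace ℝ V) := (WithLp.equiv 2 (V → ℝ)).nontrivial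
  have h := measure_norm_sum_smul_gt_le (EuclideanSpace.basisFun V ℝ)
    (X := fun t => toEuclideanCLM (n := V) (𝕜 := ℝ) (X t)) hX (fun t => by
      rw [IsSelfAdjoint, ← map_star, star_eq_conjTranspose, conjTranspose_eq_transpose_of_trivial,
        hXs]) hv hθ
  simpa only [opNorm, map_sum, map_smul] using h

theorem measurableSet_opNorm_sum_smul_gt {ι : Type*} [Fintype ι] (X : ι → Matrix V V ℝ) (c : ℝ) :
    MeasurableSet {y : ι → ℝ | c < opNorm (∑ t, y t • X t)} := by
  simp only [opNorm, map_sum, map_smul]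
  exact measurableSet_lt measurable_const (continuous_norm_sum_smul _).measurable

end

/-- Conditioning on an independent finite-valued variable: if for each of its values the bad event
has probability at most `δ`, so it has conditionally on any event that this variable determines. -/
theorem ofReal_one_sub_le_cond {Ω α β : Type*} [MeasurableSpace Ω] [MeasurableSpace β] [Finite α]
    [MeasurableSpace α] [MeasurableSingletonClass α] {P : Measure Ω} [IsProbabilityMeasure P]
    {f : Ω → α} {g : Ω → β} (hf : Measurable f) (hfg : IndepFun f g P) {A : Set α} {N : α → Set β}
    (hN : ∀ a, MeasurableSet (N a)) {δ : ℝ} (hδ : 0 ≤ δ)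
    (hNδ : ∀ a, P (g ⁻¹' N a) ≤ ENNReal.ofReal δ) (hA : P (f ⁻¹' A) ≠ 0) {t : Set Ω}
    (ht : ∀ ω, f ω ∈ A → g ω ∉ N (f ω) → ω ∈ t) :
    ENNReal.ofReal (1 - δ) ≤ P[t | f ⁻¹' A] := by
  classical
  have := Fintype.ofFinite α
  have hAm : MeasurableSet (f ⁻¹' A) := hf A.toFinite.measurableSet
  have hsum : ∑ a ∈ A.toFinset, P (f ⁻¹' {a}) = P (f ⁻¹' A) := by
    rw [sum_measure_preimage_singleton _ fun a _ => hf (measurableSet_singleton a),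
      Set.coe_toFinset]
  have hbad : P (f ⁻¹' A \ t) ≤ ENNReal.ofReal δ * P (f ⁻¹' A) := by
    calc P (f ⁻¹' A \ t) ≤ P (⋃ a ∈ A.toFinset, f ⁻¹' {a} ∩ g ⁻¹' N a) := by
          refine measure_mono fun ω hω => ?_
          simp only [Set.mem_iUnion]
          refine ⟨f ω, by simpa using hω.1, rfl, ?_⟩
          by_contra hcon
          exact hω.2 (ht ω hω.1 hcon)
      _ ≤ ∑ a ∈ A.toFinset, P (f ⁻¹' {a} ∩ g ⁻¹' N a) := measure_biUnion_finset_le _ _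
      _ ≤ ∑ a ∈ A.toFinset, ENNReal.ofReal δ * P (f ⁻¹' {a}) := by
          refine Finset.sum_le_sum fun a _ => ?_
          rw [hfg.measure_inter_preimage_eq_mul _ _ (measurableSet_singleton a) (hN a), mul_comm]
          gcongr
          exact hNδ a
      _ = _ := by rw [← Finset.mul_sum, hsum]
  rw [cond_apply hAm, mul_comm, ← div_eq_mul_inv,
    ENNReal.le_div_iff_mul_le (Or.inl hA) (Or.inl (measure_ne_top _ _)),
    ENNReal.ofReal_sub _ hδ, ENNReal.ofReal_one,
    ENNReal.sub_mul fun _ _ => measure_ne_top _ _, one_mul]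
  refine tsub_le_iff_right.mpr ?_
  refine (measure_le_inter_add_sdiff P (f ⁻¹' A) t).trans ?_
  gcongr

end OpinionBandit

/-! ### The estimation error bound -/

theorem mainTheorem2 {V : Type*} [Fintype V] [DecidableEq V] {K T₁ : ℕ} (hT₁ : 0 < T₁)
    (G : Fin K → WeightedGraph V) (s : V → ℝ)
    (S : Submodule ℝ (Matrix V V ℝ)) (hS : OpinionBandit.trueParam s ∈ S)
    {Ω : Type*} [MeasurableSpace Ω] (P : MeasureTheory.Measure Ω)
    [MeasureTheory.IsProbabilityMeasure P]
    (arm : Fin T₁ → Ω → Fin K) (harm : ∀ t, Measurable (arm t))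
    (η : Fin T₁ → Ω → ℝ) (v : ℝ≥0) (hv : v ≤ 1)
    (hη : ∀ t, ProbabilityTheory.HasLaw (η t) (ProbabilityTheory.gaussianReal 0 v) P)
    (hη_indep : ProbabilityTheory.iIndepFun η P)
    (harm_indep : ProbabilityTheory.IndepFun (fun ω t => arm t ω) (fun ω t => η t ω) P)
    (δ : ℝ) (hδ0 : 0 < δ) (hδ1 : δ < 1)
    (κ τ : ℝ) (hκ : 0 < κ) (hκτ : 128 * τ ^ 2 ≤ κ)
    (hRSC : P {ω | OpinionBandit.RSC S s (fun t => (G (arm t ω)).forestMatrix) κ τ} ≠ 0) :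
    ENNReal.ofReal (1 - δ) ≤
      ProbabilityTheory.cond P
        {ω | OpinionBandit.RSC S s (fun t => (G (arm t ω)).forestMatrix) κ τ}
        {ω | ∀ Θ : Matrix V V ℝ,
          OpinionBandit.IsEstimator S (fun t => (G (arm t ω)).forestMatrix)
            (fun t => OpinionBandit.traceInner (OpinionBandit.trueParam s)
              (G (arm t ω)).forestMatrix + η t ω)
            (2 * √(2 * Real.log (2 * (Fintype.card V : ℝ) / δ) / (T₁ : ℝ))) Θ →
          ‖Θ - OpinionBandit.trueParam s‖ ^ 2 ≤
            36 * Real.log (2 * (Fintype.card V : ℝ) / δ) / (κ ^ 2 * (T₁ : ℝ))} := by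
  -- For empty `V` the logarithm is `log 0 = 0` and all matrices coincide.
  rcases isEmpty_or_nonempty V with hV | hV
  · have := ProbabilityTheory.cond_isProbabilityMeasure hRSC
    have huniv : {ω | ∀ Θ : Matrix V V ℝ,
        OpinionBandit.IsEstimator S (fun t => (G (arm t ω)).forestMatrix)
          (fun t => OpinionBandit.traceInner (OpinionBandit.trueParam s)
            (G (arm t ω)).forestMatrix + η t ω)
          (2 * √(2 * Real.log (2 * (Fintype.card V : ℝ) / δ) / (T₁ : ℝ))) Θ →
        ‖Θ - OpinionBandit.trueParam s‖ ^ 2 ≤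
          36 * Real.log (2 * (Fintype.card V : ℝ) / δ) / (κ ^ 2 * (T₁ : ℝ))} = Set.univ := by
      refine Set.eq_univ_of_forall fun ω Θ _ => ?_
      rw [Subsingleton.elim (Θ - OpinionBandit.trueParam s) 0]
      simp
    rw [huniv, MeasureTheory.measure_univ]
    exact ENNReal.ofReal_le_one.mpr (by linarith)
  have hT : (0 : ℝ) < T₁ := Nat.cast_pos.mpr hT₁
  have hd : (1 : ℝ) ≤ Fintype.card V := Nat.one_le_cast.mpr Fintype.card_pos
  set d : ℝ := ((Fintype.card V : ℕ) : ℝ) with hd_def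
  set ℓ : ℝ := Real.log (2 * d / δ) with hℓ
  have hquot : 1 < 2 * d / δ := by rw [one_lt_div hδ0]; linarith
  have hℓ0 : 0 < ℓ := Real.log_pos hquot
  -- The penalty level is `2 θ`, and the good event is that the noise `∑ t, η t • X t` has operator
  -- norm at most `T₁ θ`.
  set θ : ℝ := √(2 * ℓ / T₁) with hθ
  have hθ0 : 0 < θ := Real.sqrt_pos.mpr (by positivity)
  have hθ2 : θ ^ 2 = 2 * ℓ / T₁ := Real.sq_sqrt (by positivity)
  have hlaw : P.map (fun ω t => η t ω) =
      MeasureTheory.Measure.pi fun _ : Fin T₁ => ProbabilityTheory.gaussianReal 0 v := by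
    rw [(ProbabilityTheory.iIndepFun_iff_map_fun_eq_pi_map fun t => (hη t).aemeasurable).mp
      hη_indep]
    simp only [(hη _).map_eq]
  have hηm : AEMeasurable (fun ω t => η t ω) P :=
    aemeasurable_pi_lambda _ fun t => (hη t).aemeasurable
  have hbound : 2 * d * Real.exp (-(Fintype.card (Fin T₁) * θ ^ 2 / 2)) = δ := by
    have h1 : (Fintype.card (Fin T₁) : ℝ) * θ ^ 2 / 2 = ℓ := by
      rw [hθ2, Fintype.card_fin]; field_simp
    rw [h1, hℓ, Real.exp_neg, Real.exp_log (by linarith)]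
    field_simp
  refine OpinionBandit.ofReal_one_sub_le_cond (f := fun ω t => arm t ω) (g := fun ω t => η t ω)
    (A := {a | OpinionBandit.RSC S s (fun t => (G (a t)).forestMatrix) κ τ})
    (N := fun a => {y | (Fintype.card (Fin T₁) : ℝ) * θ <
      OpinionBandit.opNorm (∑ t, y t • (G (a t)).forestMatrix)})
    (measurable_pi_lambda _ harm) harm_indep
    (fun a => OpinionBandit.measurableSet_opNorm_sum_smul_gt _ _) hδ0.le (fun a => ?_) hRSC
    fun ω hω hωN Θ hΘ => ?_
  · rw [← MeasureTheory.Measure.map_apply_of_aemeasurable hηm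
      (OpinionBandit.measurableSet_opNorm_sum_smul_gt _ _), hlaw, ← hbound]
    exact OpinionBandit.measure_opNorm_sum_smul_gt_le
      (fun t => (G (a t)).opNorm_forestMatrix_le_one) (fun t => (G (a t)).transpose_forestMatrix)
      hv hθ0.le
  · have hnoise : OpinionBandit.opNorm (∑ t, η t ω • (G (arm t ω)).forestMatrix) ≤
        T₁ * (2 * θ / 2) := by
      have := not_lt.mp (Set.notMem_ofPred_iff.mp hωN)
      rw [Fintype.card_fin] at this
      linarith
    have h := hΘ.sq_norm_sub_le hT₁ (by positivity) hκ hκτ hS hω hnoise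
    rw [mul_pow, hθ2] at h
    rw [le_div_iff₀ (by positivity)]
    calc ‖Θ - OpinionBandit.trueParam s‖ ^ 2 * (κ ^ 2 * T₁)
        = κ ^ 2 * ‖Θ - OpinionBandit.trueParam s‖ ^ 2 * T₁ := by ring
      _ ≤ 9 / 2 * (2 ^ 2 * (2 * ℓ / T₁)) * T₁ := by gcongr
      _ = 36 * ℓ := by field_simp; norm_num
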